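/- **Theorem (Adiabatic theorem for systematic error).** Let $E$ be a complex Hilbert space. Below, a *Hamiltonian* is a self-adjoint operator on $E$ (bounded, or unbounded and densely defined) that has a countable complete orthonormal system of eigenvectors. For $s\in[0,1]$ let $\mathcal H(s)$ and $$\mathcal H_\epsilon(s)=\mathcal H(s)+\epsilon\,\Delta(s),\qquad \epsilon\in\mathbb R,$$ be Hamiltonians, where $\Delta(s)$ are linear operators. Assume that $\mathcal H_\epsilon$ is twice differentiable on $[0,1]$ in operator norm (one-sidedly at the end points; if the operators are unbounded, this means that $\mathcal H_\epsilon(s)$ has a domain independent of $s$ and that $\mathcal H_\epsilon(s)-\mathcal H_\epsilon(0)$ is bounded and twice differentiable in norm), and that for all $s\in[0,1]$ $$\|\dot{\mathcal H}_\epsilon(s)\|\le \bar b_1,\qquad \|\ddot{\mathcal H}_\epsilon(s)\|\le \bar b_2 .$$ Assume that for every $s\in[0,1]$ the operator $\mathcal H_\epsilon(s)$ has a lowest eigenvalue, that this eigenvalue is simple, with normalized ground state $\psi_0(s)$, and that every other eigenvalue of $\mathcal H_\epsilon(s)$ exceeds it by at least $\bar\gamma_\epsilon$, where $\bar\gamma_\epsilon>0$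 is a constant (for example, the minimum over $s\in[0,1]$ of the gap between the ground state energy and the first excited energy). Assume that, for $s=0$ and $s=1$, $\mathcal H(s)$ has a lowest eigenvalue and that it is simple, with normalized ground state $\phi_0(s)$, and put $$\delta_0=\sqrt{1-|\langle\psi_0(0),\phi_0(0)\rangle|^2},\qquad \delta_1=\sqrt{1-|\langle\psi_0(1),\phi_0(1)\rangle|^2}.$$ For $s\in\{0,1\}$ let $P(s)$ be the orthogonal projection onto the line spanned by $\phi_0(s)$, and let $Q(s)=I-P(s)$. Let $\tau>0$, and let $U_\epsilon(s)$, $s\in[0,1]$, be the evolution operator, that is, the bounded operators with $$\dot U_\epsilon(s)=-i\tau\,\mathcal H_\epsilon(s)\,U_\epsilon(s),\qquad U_\epsilon(0)=I$$ (where the equation is understood on every vector of the domain of $\mathcal H_\epsilon$). Then, in operator norm, $$\|Q(1)\,U_\epsilon(1)\,P(0)\|\;\le\;\frac{8}{\tau\bar\gamma_\epsilon^{2}}\left(2\bar b_1+\bar b_2+\frac{16\,\bar b_1^{2}}{\bar\gamma_\epsilon}\right)+\delta_0+\delta_1+\delta_0\delta_1 .$$ -/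

import Mathlib

open scoped InnerProductSpace

noncomputable section

namespace Adiabatic

variable {E : Type*} [NormedAddCommGroup E] [InnerProductSpace ℂ E]

/-- The space of vectors `x` in the domain of the (possibly unbounded) operator `A`
with `A x = μ x`. -/
def eigenspace (A : E →ₗ.[ℂ] E) (μ : ℝ) : Submodule ℂ E :=
  (LinearMap.ker (A.toFun - (μ : ℂ) • A.domain.subtype)).map A.domain.subtype

/-- The energy levels of `A`, that is, its (real) eigenvalues. -/
def energies (A : E →ₗ.[ℂ] E) : Set ℝ := {μ | eigenspace A μ ≠ ⊥}

/-- A Hamiltonian: a self-adjoint operator (bounded, or unbounded and densely defined) that has a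
countable complete orthonormal system of eigenstates. The index set is an arbitrary set of
naturals, so that finite and infinite dimension are both covered. -/
def IsHamiltonian [CompleteSpace E] (A : E →ₗ.[ℂ] E) : Prop :=
  IsSelfAdjoint A ∧
    ∃ (J : Set ℕ) (e : HilbertBasis J ℂ E) (lam : J → ℝ), ∀ j, e j ∈ eigenspace A (lam j)

/-- `φ` is the normalized (unique up to a phase) ground state of `A`: there is a lowest energy, and
its eigenspace is the line through the unit vector `φ`. -/
def IsGroundState (A : E →ₗ.[ℂ] E) (φ : E) : Prop :=
  ‖φ‖ = 1 ∧ ∃ E₀ : ℝ, IsLeast (energies A) E₀ ∧ eigenspace A E₀ = Submodule.span ℂ {φ}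

/-- There is a lowest energy, and every other energy exceeds it by at least `γ`. -/
def HasGap (A : E →ₗ.[ℂ] E) (γ : ℝ) : Prop :=
  ∃ E₀ : ℝ, IsLeast (energies A) E₀ ∧ ∀ μ ∈ energies A, μ ≠ E₀ → γ ≤ μ - E₀

/-- The orthogonal projection onto the line through `φ`; for a ground state `φ` this is the
projection onto the ground state space. -/
def proj (φ : E) : E →L[ℂ] E := (Submodule.span ℂ {φ}).starProjection

/-- The family `K s`, `0 ≤ s ≤ 1`, is twice differentiable in operator norm, with first derivative
`K₁` and second derivative `K₂`. The operators may be unbounded, but the differences `K s - K 0` are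
bounded operators `V s` (so the domain does not depend on `s`). At the end points the derivatives
are one-sided. -/
def HasTwoDerivatives (K : ℝ → E →ₗ.[ℂ] E) (K₁ K₂ : ℝ → E →L[ℂ] E) : Prop :=
  ∃ V : ℝ → E →L[ℂ] E, ∀ s ∈ Set.Icc (0 : ℝ) 1,
    K s = (V s : E →ₗ[ℂ] E) +ᵥ K 0 ∧
      HasDerivWithinAt V (K₁ s) (Set.Icc 0 1) s ∧ HasDerivWithinAt K₁ (K₂ s) (Set.Icc 0 1) s

/-- `U` is the evolution operator on `0 ≤ s ≤ 1` of the Schrödinger equation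
`dU/ds = -i τ K(s) U(s)`, `U(0) = I`. The equation is required on every vector of the
domain of `K 0`; for bounded operators this is every vector. -/
def IsEvolution (K : ℝ → E →ₗ.[ℂ] E) (τ : ℝ) (U : ℝ → E →L[ℂ] E) : Prop :=
  U 0 = ContinuousLinearMap.id ℂ E ∧
    ∀ x ∈ (K 0).domain, ∀ s ∈ Set.Icc (0 : ℝ) 1, ∃ h : U s x ∈ (K s).domain,
      HasDerivWithinAt (fun r => U r x) (-(Complex.I * (τ : ℂ)) • K s ⟨U s x, h⟩)
        (Set.Icc 0 1) s

end Adiabatic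

end

/-! Write `P` for the projection onto the perturbed ground state, `e` for its energy, and `G` for
the inverse of `A - e + γ P`. The gap gives `‖G‖ ≤ γ⁻¹`, and perturbation theory with `G` shows that
`P`, `e` and `G` are differentiable in norm, with `P' = -(M + M*)` and `M = G (1 - P) K₁ P`
(`hasDerivWithinAt_proj`). Only projections are differentiated, so the phase of `ψ s` is free to
jump.

For a solution `x`, the leak `x - P x` is driven by `M x + M* x`, which is not small. Adding `(i/τ)
T x` with `T = G M` removes `M x`, because `(A - e) T = M`. The remaining `M* x` lies in the range
of `P`, orthogonal to the corrected leak `w`. Hence `‖w‖` changes only through `(i/τ) T' x`, which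
is `O(1/τ)`; this is `norm_sub_proj_le_of_schrodinger`, a differential form of the usual integration
by parts.

Applied to `x 0 = ψ 0`, this bounds the leak between perturbed ground states. `norm_transition_le`
then exchanges `ψ` for `φ` at both ends, at a cost of `δ₀ + δ₁`. The constants obtained are smaller
than the stated ones. -/

namespace Adiabatic

/-! ### Inverse of the shifted Hamiltonian, from the eigenbasis. -/

section Spectral

variable {E : Type*} [NormedAddCommGroup E] [InnerProductSpace ℂ E]

/-- Spectral data of a symmetric operator `A` with domain `D`, nondegenerate lowest energy `e`,
ground state `ψ` and gap `γ`: `G` is the inverse of `A - e + γ P`, `P` the projection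
onto the ground state. -/
structure SpectralData {D : Submodule ℂ E} (A : D →ₗ[ℂ] E) (ψ : E) (γ e : ℝ) (G : E →L[ℂ] E) :
    Prop where
  norm_ground : ‖ψ‖ = 1
  ground_mem : ψ ∈ D
  map_ground : A ⟨ψ, ground_mem⟩ = (e : ℂ) • ψ
  symm : ∀ x y : D, ⟪A x, (y : E)⟫_ℂ = ⟪(x : E), A y⟫_ℂ
  lower : ∀ x : D, e * ‖(x : E)‖ ^ 2 ≤ (⟪(x : E), A x⟫_ℂ).re
  inv_mem : ∀ y, G y ∈ D
  map_inv : ∀ y, A ⟨G y, inv_mem y⟩ - (e : ℂ) • G y + (γ : ℂ) • proj ψ (G y) = y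
  inv_map : ∀ x : D, G (A x - (e : ℂ) • (x : E) + (γ : ℂ) • proj ψ (x : E)) = x
  norm_inv : ‖G‖ ≤ γ⁻¹

theorem mem_eigenspace {A : E →ₗ.[ℂ] E} {μ : ℝ} {x : E} :
    x ∈ eigenspace A μ ↔ ∃ h : x ∈ A.domain, A ⟨x, h⟩ = (μ : ℂ) • x := by
  simp only [eigenspace, Submodule.mem_map, LinearMap.mem_ker, LinearMap.sub_apply,
    LinearMap.smul_apply, Submodule.subtype_apply, sub_eq_zero]
  constructor
  · rintro ⟨⟨y, hy⟩, h, rfl⟩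
    exact ⟨hy, h⟩
  · rintro ⟨h, h'⟩
    exact ⟨⟨x, h⟩, h', rfl⟩

theorem mem_energies {A : E →ₗ.[ℂ] E} {μ : ℝ} {x : E} (hx : x ∈ eigenspace A μ) (h0 : x ≠ 0) :
    μ ∈ energies A := fun h => h0 (by simpa [h] using hx)

theorem proj_apply {φ : E} (hφ : ‖φ‖ = 1) (x : E) : proj φ x = ⟪φ, x⟫_ℂ • φ :=
  Submodule.starProjection_unit_singleton ℂ hφ x

theorem proj_inner (φ x y : E) : ⟪proj φ x, y⟫_ℂ = ⟪x, proj φ y⟫_ℂ :=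
  Submodule.starProjection_isSymmetric _ x y

theorem proj_proj (φ x : E) : proj φ (proj φ x) = proj φ x :=
  Submodule.starProjection_eq_self_iff.mpr (Submodule.starProjection_apply_mem _ _)

theorem proj_self (φ : E) : proj φ φ = φ :=
  Submodule.starProjection_eq_self_iff.mpr (Submodule.mem_span_singleton_self φ)

theorem norm_proj_le (φ : E) : ‖proj φ‖ ≤ 1 := Submodule.starProjection_norm_le _

theorem norm_id_sub_proj_le (φ : E) : ‖ContinuousLinearMap.id ℂ E - proj φ‖ ≤ 1 := by
  have := Submodule.starProjection_orthogonal' (𝕜 := ℂ) (Submodule.span ℂ {φ})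
  rw [proj, show ContinuousLinearMap.id ℂ E = 1 from rfl, ← this]
  exact Submodule.starProjection_norm_le _

theorem IsGroundState.ext_energy {A : E →ₗ.[ℂ] E} {ψ : E} {γ : ℝ} (h : IsGroundState A ψ)
    (hg : HasGap A γ) : ‖ψ‖ = 1 ∧ ∃ e : ℝ, IsLeast (energies A) e ∧
      eigenspace A e = Submodule.span ℂ {ψ} ∧ ∀ μ ∈ energies A, μ ≠ e → γ ≤ μ - e := by
  obtain ⟨h1, e, he, hs⟩ := h
  obtain ⟨e', he', hg⟩ := hg
  obtain rfl := he.unique he'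
  exact ⟨h1, e, he, hs, hg⟩

theorem hasSum_norm_inner_sq {ι : Type*} (b : HilbertBasis ι ℂ E) (x : E) :
    HasSum (fun j => ‖⟪b j, x⟫_ℂ‖ ^ 2) (‖x‖ ^ 2) := by
  have h := b.hasSum_inner_mul_inner x x
  have h2 := Complex.hasSum_re h
  rw [show (⟪x, x⟫_ℂ).re = ‖x‖ ^ 2 from (norm_sq_eq_re_inner (𝕜 := ℂ) x).symm] at h2
  convert h2 using 2 with j
  rw [← inner_conj_symm x (b j), mul_comm, Complex.mul_conj, Complex.normSq_eq_norm_sq,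
    Complex.ofReal_re]

variable [CompleteSpace E]

theorem inner_map_symm {A : E →ₗ.[ℂ] E} (hA : IsSelfAdjoint A) (x y : A.domain) :
    ⟪A x, (y : E)⟫_ℂ = ⟪(x : E), A y⟫_ℂ := by
  have h := LinearPMap.adjoint_isFormalAdjoint hA.dense_domain
  rw [LinearPMap.isSelfAdjoint_def.mp hA] at h
  exact h x y

/-- Here self-adjointness is used beyond symmetry: the domain of `A` is all of the domain of its
adjoint, so a weak solution of `A x = z` is a solution. -/
theorem exists_map_eq_of_inner {A : E →ₗ.[ℂ] E} (hA : IsSelfAdjoint A) (x z : E)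
    (h : ∀ u : A.domain, ⟪z, (u : E)⟫_ℂ = ⟪x, A u⟫_ℂ) : ∃ hx : x ∈ A.domain, A ⟨x, hx⟩ = z := by
  have key : ∀ B : E →ₗ.[ℂ] E, B = A.adjoint → ∃ hx : x ∈ B.domain, B ⟨x, hx⟩ = z := by
    rintro B rfl
    have hx := LinearPMap.mem_adjoint_domain_of_exists x ⟨z, h⟩
    exact ⟨hx, LinearPMap.adjoint_apply_eq hA.dense_domain ⟨x, hx⟩ h⟩
  exact key A (LinearPMap.isSelfAdjoint_def.mp hA).symm

/-- In the eigenbasis `A - e + γ P` is diagonal, with entry `γ` on the ground state and `lam j - e ≥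
γ` elsewhere. Parseval turns this into a lower bound and builds preimages. -/
theorem exists_spectralData {A : E →ₗ.[ℂ] E} {ψ : E} {γ : ℝ} (hA : IsHamiltonian A)
    (hψ : IsGroundState A ψ) (hγ : 0 < γ) (hg : HasGap A γ) :
    ∃ (e : ℝ) (G : E →L[ℂ] E), SpectralData A.toFun ψ γ e G := by
  obtain ⟨h1, e, he, hs, hgap⟩ := hψ.ext_energy hg
  obtain ⟨hsa, J, b, lam, hb⟩ := hA
  have hsymm := inner_map_symm hsa
  have hψe : ψ ∈ eigenspace A e := hs ▸ Submodule.mem_span_singleton_self ψ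
  obtain ⟨hmem, hAψ⟩ := mem_eigenspace.mp hψe
  have hb0 : ∀ j, b j ≠ 0 := fun j => b.orthonormal.ne_zero j
  have hlam : ∀ j, lam j ∈ energies A := fun j => mem_energies (hb j) (hb0 j)
  have hcoef : ∀ (j) (x : A.domain), ⟪b j, A x⟫_ℂ = (lam j : ℂ) * ⟪b j, (x : E)⟫_ℂ := by
    intro j x
    obtain ⟨hj, hAj⟩ := mem_eigenspace.mp (hb j)
    rw [← hsymm ⟨b j, hj⟩ x, hAj, inner_smul_left, Complex.conj_ofReal]
  have hproj : ∀ j x, ⟪b j, proj ψ x⟫_ℂ = if lam j = e then ⟪b j, x⟫_ℂ else 0 := by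
    intro j x
    split_ifs with h
    · have : b j ∈ Submodule.span ℂ {ψ} := hs ▸ h ▸ hb j
      rw [← proj_inner, proj, Submodule.starProjection_eq_self_iff.mpr this]
    · have h2 := hcoef j ⟨ψ, hmem⟩
      rw [hAψ, inner_smul_right] at h2
      have h3 : ((lam j : ℂ) - e) * ⟪b j, ψ⟫_ℂ = 0 := by
        linear_combination -h2
      have h4 : ((lam j : ℂ) - e) ≠ 0 := by
        rw [sub_ne_zero]; exact_mod_cast h
      rw [proj_apply h1, inner_smul_right, (mul_eq_zero.mp h3).resolve_left h4, mul_zero]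
  set ν : J → ℝ := fun j => if lam j = e then γ else lam j - e with hν
  have hνγ : ∀ j, γ ≤ ν j := by
    intro j
    simp only [hν]
    split_ifs with h
    · exact le_rfl
    · exact hgap _ (hlam j) h
  let S : A.domain →ₗ[ℂ] E := A.toFun - (e : ℂ) • A.domain.subtype +
    (γ : ℂ) • ((proj ψ : E →ₗ[ℂ] E) ∘ₗ A.domain.subtype)
  have hS : ∀ x : A.domain, S x = A x - (e : ℂ) • (x : E) + (γ : ℂ) • proj ψ (x : E) :=
    fun x => rfl
  have hScoef : ∀ j (x : A.domain), ⟪b j, S x⟫_ℂ = (ν j : ℂ) * ⟪b j, (x : E)⟫_ℂ := by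
    intro j x
    rw [hS, inner_add_right, inner_sub_right, inner_smul_right, inner_smul_right, hcoef, hproj]
    simp only [hν]
    split_ifs with h
    · rw [h]; ring
    · push_cast; ring
  have hlow : ∀ x : A.domain, γ * ‖(x : E)‖ ≤ ‖S x‖ := by
    intro x
    have h2 : γ ^ 2 * ‖(x : E)‖ ^ 2 ≤ ‖S x‖ ^ 2 := by
      refine hasSum_le ?_ ((hasSum_norm_inner_sq b (x : E)).mul_left (γ ^ 2))
        (hasSum_norm_inner_sq b (S x))
      intro j
      rw [hScoef, norm_mul, mul_pow, Complex.norm_real, Real.norm_eq_abs, sq_abs]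
      gcongr
      exact hνγ j
    rw [← mul_pow] at h2
    exact le_of_sq_le_sq h2 (norm_nonneg _)
  have hinj : Function.Injective S := by
    rw [← LinearMap.ker_eq_bot, LinearMap.ker_eq_bot']
    intro x hx
    have := hlow x
    rw [hx, norm_zero] at this
    have h0 : ‖(x : E)‖ = 0 := by
      by_contra h
      have := mul_pos hγ (lt_of_le_of_ne (norm_nonneg _) (Ne.symm h))
      linarith
    exact Subtype.ext (norm_eq_zero.mp h0)
  have hsurj : Function.Surjective S := by
    intro y
    have hmemℓ : Memℓp (fun j => ((ν j : ℂ))⁻¹ * ⟪b j, y⟫_ℂ) 2 := by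
      apply memℓp_gen
      have hsum := ((hasSum_norm_inner_sq b y).mul_left ((γ⁻¹) ^ 2)).summable
      refine Summable.of_nonneg_of_le (fun j => by positivity) (fun j => ?_) hsum
      simp only [ENNReal.toReal_ofNat, Real.rpow_ofNat]
      rw [norm_mul, mul_pow, norm_inv, Complex.norm_real, Real.norm_eq_abs,
        abs_of_pos (hγ.trans_le (hνγ j))]
      have := hγ.trans_le (hνγ j)
      gcongr
      exact hνγ j
    set x : E := b.repr.symm ⟨_, hmemℓ⟩ with hx
    have hxc : ∀ j, ⟪b j, x⟫_ℂ = ((ν j : ℂ))⁻¹ * ⟪b j, y⟫_ℂ := by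
      intro j
      rw [← b.repr_apply_apply, hx, LinearIsometryEquiv.apply_symm_apply]
    -- The right-hand side is the value `A x` must take for `S x = y`; membership of `x` in the
    -- domain is checked weakly, coefficient by coefficient.
    obtain ⟨hxm, hAx⟩ := exists_map_eq_of_inner hsa x
      (y + (e : ℂ) • x - (γ : ℂ) • proj ψ x) (by
        intro u
        rw [← b.tsum_inner_mul_inner, ← b.tsum_inner_mul_inner x]
        refine tsum_congr fun j => ?_
        rw [hcoef, ← inner_conj_symm _ (b j), ← inner_conj_symm x (b j)]
        have : ⟪b j, y + (e : ℂ) • x - (γ : ℂ) • proj ψ x⟫_ℂ = (lam j : ℂ) * ⟪b j, x⟫_ℂ := by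
          have hy : ⟪b j, y⟫_ℂ = (ν j : ℂ) * ⟪b j, x⟫_ℂ := by
            have : (ν j : ℂ) ≠ 0 := by exact_mod_cast (hγ.trans_le (hνγ j)).ne'
            rw [hxc]; field_simp
          rw [inner_sub_right, inner_add_right, inner_smul_right, inner_smul_right, hproj, hy]
          simp only [hν]
          split_ifs with h
          · rw [h]; ring
          · push_cast; ring
        rw [this, map_mul, Complex.conj_ofReal]
        ring)
    refine ⟨⟨x, hxm⟩, ?_⟩
    rw [hS, hAx]
    dsimp only
    abel
  let F := LinearEquiv.ofBijective S ⟨hinj, hsurj⟩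
  have hFS : ∀ y, S (F.symm y) = y := fun y => F.apply_symm_apply y
  let G : E →L[ℂ] E := (A.domain.subtype ∘ₗ F.symm.toLinearMap).mkContinuous γ⁻¹ (by
    intro y
    have := hlow (F.symm y)
    rw [hFS] at this
    rw [← div_eq_inv_mul, le_div_iff₀ hγ, mul_comm]
    exact this)
  have hG : ∀ y, G y = F.symm y := fun y => rfl
  refine ⟨e, G, h1, hmem, hAψ, hsymm, ?_, fun y => (F.symm y).2, fun y => hFS y, ?_, ?_⟩
  · intro x
    have h2 := (Complex.hasSum_re (b.hasSum_inner_mul_inner (x : E) (A x)))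
    refine hasSum_le ?_ ((hasSum_norm_inner_sq b (x : E)).mul_left e) h2
    intro j
    rw [hcoef, ← inner_conj_symm (x : E) (b j), mul_left_comm, mul_comm _ ⟪b j, _⟫_ℂ,
      Complex.mul_conj, Complex.normSq_eq_norm_sq, ← Complex.ofReal_mul, Complex.ofReal_re]
    have := he.2 (hlam j)
    gcongr
  · intro x
    rw [hG]
    exact congrArg Subtype.val (F.symm_apply_apply x)
  · exact LinearMap.mkContinuous_norm_le _ (by positivity) _

end Spectral

/-! ### Finite perturbation estimates for energy, projection and inverse. -/

section Algebra

variable {E : Type*} [NormedAddCommGroup E] [InnerProductSpace ℂ E]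
variable {D : Submodule ℂ E} {A A' : D →ₗ[ℂ] E} {ψ ψ' : E} {γ e e' : ℝ} {G G' W : E →L[ℂ] E}

theorem proj_mul_proj (φ : E) : proj φ * proj φ = proj φ :=
  ContinuousLinearMap.ext fun x => proj_proj φ x

namespace SpectralData

theorem proj_mem (h : SpectralData A ψ γ e G) (x : E) : proj ψ x ∈ D := by
  rw [proj_apply h.norm_ground]
  exact D.smul_mem _ h.ground_mem

theorem map_proj (h : SpectralData A ψ γ e G) (x : E) :
    A ⟨proj ψ x, h.proj_mem x⟩ = (e : ℂ) • proj ψ x := by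
  have : (⟨proj ψ x, h.proj_mem x⟩ : D) = ⟪ψ, x⟫_ℂ • ⟨ψ, h.ground_mem⟩ :=
    Subtype.ext (proj_apply h.norm_ground x)
  rw [this, map_smul, h.map_ground, proj_apply h.norm_ground, smul_comm]

theorem proj_map (h : SpectralData A ψ γ e G) (x : D) :
    proj ψ (A x) = (e : ℂ) • proj ψ (x : E) := by
  rw [proj_apply h.norm_ground, proj_apply h.norm_ground]
  have := h.symm ⟨ψ, h.ground_mem⟩ x
  rw [h.map_ground, inner_smul_left, Complex.conj_ofReal] at this
  rw [← this, mul_smul]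

theorem inv_mul_proj (h : SpectralData A ψ γ e G) (hγ : 0 < γ) :
    G * proj ψ = (γ : ℂ)⁻¹ • proj ψ := by
  ext x
  have h1 := h.inv_map ⟨proj ψ x, h.proj_mem x⟩
  rw [h.map_proj, sub_self, zero_add, proj_proj, map_smul] at h1
  have hγ' : (γ : ℂ) ≠ 0 := by exact_mod_cast hγ.ne'
  rw [eq_comm, smul_apply, inv_smul_eq_iff₀ hγ']
  exact h1.symm

theorem proj_mul_inv (h : SpectralData A ψ γ e G) (hγ : 0 < γ) :
    proj ψ * G = (γ : ℂ)⁻¹ • proj ψ := by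
  ext x
  have h1 := congrArg (proj ψ) (h.map_inv x)
  rw [map_add, map_sub, h.proj_map, map_smul, map_smul, sub_self, zero_add, proj_proj] at h1
  have hγ' : (γ : ℂ) ≠ 0 := by exact_mod_cast hγ.ne'
  rw [eq_comm, smul_apply, inv_smul_eq_iff₀ hγ']
  exact h1.symm

theorem inv_mul_compl (h : SpectralData A ψ γ e G) (hγ : 0 < γ) :
    G * (1 - proj ψ) = (1 - proj ψ) * G := by
  rw [mul_sub, sub_mul, h.inv_mul_proj hγ, h.proj_mul_inv hγ, mul_one, one_mul]

theorem inv_map_sub (h : SpectralData A ψ γ e G) (hγ : 0 < γ) (x : D) :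
    G (A x - (e : ℂ) • (x : E)) = (x : E) - proj ψ (x : E) := by
  have h1 := h.inv_map x
  have h2 := congrArg (fun T : E →L[ℂ] E => T (x : E)) (h.inv_mul_proj hγ)
  have h3 : G (proj ψ (x : E)) = (γ : ℂ)⁻¹ • proj ψ (x : E) := h2
  have hγ' : (γ : ℂ) ≠ 0 := by exact_mod_cast hγ.ne'
  rw [map_add, map_smul, h3, smul_inv_smul₀ hγ'] at h1
  exact eq_sub_of_add_eq h1

theorem map_inv_sub (h : SpectralData A ψ γ e G) (hγ : 0 < γ) (y : E) :
    A ⟨G y, h.inv_mem y⟩ - (e : ℂ) • G y = y - proj ψ y := by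
  have h1 := h.map_inv y
  have h3 : proj ψ (G y) = (γ : ℂ)⁻¹ • proj ψ y :=
    congrArg (fun T : E →L[ℂ] E => T y) (h.proj_mul_inv hγ)
  have hγ' : (γ : ℂ) ≠ 0 := by exact_mod_cast hγ.ne'
  rw [h3, smul_inv_smul₀ hγ'] at h1
  exact eq_sub_of_add_eq h1

/-- Variational principle: `ψ'` is a trial state for `A`. -/
theorem energy_le (h : SpectralData A ψ γ e G) (h' : SpectralData A' ψ' γ e' G')
    (hW : ∀ x : D, A' x = A x + W x) : e ≤ e' + ‖W‖ := by
  have h1 := h.lower ⟨ψ', h'.ground_mem⟩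
  have h2 := h'.map_ground
  rw [hW, ← eq_sub_iff_add_eq] at h2
  rw [h2, inner_sub_right, inner_smul_right, inner_self_eq_norm_sq_to_K, h'.norm_ground,
    Complex.sub_re] at h1
  have h3 : |(⟪ψ', W ψ'⟫_ℂ).re| ≤ ‖W‖ := by
    refine (Complex.abs_re_le_norm _).trans ((norm_inner_le_norm _ _).trans ?_)
    have := W.le_opNorm ψ'
    rwa [h'.norm_ground, mul_one, ← one_mul ‖W ψ'‖, ← h'.norm_ground] at this
  have h4 := abs_le.mp h3
  simp at h1
  linarith [h4.1]

theorem abs_energy_sub_le (h : SpectralData A ψ γ e G) (h' : SpectralData A' ψ' γ e' G')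
    (hW : ∀ x : D, A' x = A x + W x) : |e' - e| ≤ ‖W‖ := by
  have h1 := h.energy_le h' hW
  have h2 := h'.energy_le (W := -W) h (fun x => by rw [hW]; simp)
  rw [norm_neg] at h2
  rw [abs_le]
  constructor <;> linarith

/-- Apply `G` to `(A - e) P' = (e' - e) P' - W P'`, where `P'` is the projection onto `ψ'`, and use
`G (A - e) = 1 - P`. -/
theorem proj_sub_eq (h : SpectralData A ψ γ e G) (hγ : 0 < γ) (h' : SpectralData A' ψ' γ e' G')
    (hW : ∀ x : D, A' x = A x + W x) :
    proj ψ' - proj ψ * proj ψ' = G * (((e' - e : ℝ) : ℂ) • proj ψ' - W * proj ψ') := by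
  ext x
  have h1 := h.inv_map_sub hγ ⟨proj ψ' x, h'.proj_mem x⟩
  have h2 := h'.map_proj x
  rw [hW, ← eq_sub_iff_add_eq] at h2
  rw [h2] at h1
  refine h1.symm.trans (congrArg G ?_)
  change _ = ((e' - e : ℝ) : ℂ) • proj ψ' x - W (proj ψ' x)
  push_cast
  rw [sub_smul]
  abel

theorem norm_proj_sub_mul_le (h : SpectralData A ψ γ e G) (hγ : 0 < γ)
    (h' : SpectralData A' ψ' γ e' G') (hW : ∀ x : D, A' x = A x + W x) :
    ‖proj ψ' - proj ψ * proj ψ'‖ ≤ 2 * γ⁻¹ * ‖W‖ := by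
  rw [h.proj_sub_eq hγ h' hW]
  have h1 := h.abs_energy_sub_le h' hW
  calc ‖G * (((e' - e : ℝ) : ℂ) • proj ψ' - W * proj ψ')‖
      ≤ ‖G‖ * (‖((e' - e : ℝ) : ℂ)‖ * ‖proj ψ'‖ + ‖W‖ * ‖proj ψ'‖) := by
        refine (norm_mul_le _ _).trans ?_
        gcongr
        refine (norm_sub_le _ _).trans ?_
        gcongr
        · exact (norm_smul_le (((e' - e : ℝ) : ℂ)) (proj ψ'))
        · exact norm_mul_le _ _
    _ ≤ γ⁻¹ * (‖W‖ * 1 + ‖W‖ * 1) := by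
        rw [Complex.norm_real, Real.norm_eq_abs]
        gcongr
        · exact h.norm_inv
        · exact norm_proj_le _
        · exact norm_proj_le _
    _ = _ := by ring

/-- Second resolvent identity for the shifted operators; the middle factor is their difference. -/
theorem inv_sub_inv (h : SpectralData A ψ γ e G) (h' : SpectralData A' ψ' γ e' G')
    (hW : ∀ x : D, A' x = A x + W x) :
    G' - G = -(G' * (W - ((e' - e : ℝ) : ℂ) • 1 + (γ : ℂ) • (proj ψ' - proj ψ)) * G) := by
  ext y
  have h1 := h.map_inv y
  have h2 := h'.inv_map ⟨G y, h.inv_mem y⟩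
  have h3 : A' ⟨G y, h.inv_mem y⟩ - (e' : ℂ) • G y + (γ : ℂ) • proj ψ' (G y) =
      y + (W (G y) - ((e' - e : ℝ) : ℂ) • G y + (γ : ℂ) • (proj ψ' (G y) - proj ψ (G y))) := by
    refine Eq.trans ?_ (congrArg (fun z => z + _) h1)
    rw [hW]
    push_cast
    module
  rw [h3, map_add] at h2
  change G' y - G y = -(G' (W (G y) - ((e' - e : ℝ) : ℂ) • G y +
    (γ : ℂ) • (proj ψ' (G y) - proj ψ (G y))))
  rw [eq_neg_iff_add_eq_zero, sub_add_eq_add_sub, sub_eq_zero]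
  exact h2

/-- First order expansion of the ground state projection, with a remainder that is quadratic
in the perturbation. -/
theorem proj_sub_proj_eq (h : SpectralData A ψ γ e G) (hγ : 0 < γ)
    (h' : SpectralData A' ψ' γ e' G') (hW : ∀ x : D, A' x = A x + W x) :
    (1 - proj ψ) * proj ψ' =
      ((e' - e : ℝ) : ℂ) • (G * (1 - proj ψ) * (proj ψ' - proj ψ))
        - G * (1 - proj ψ) * (W * proj ψ') := by
  have h0 : (1 - proj ψ) * proj ψ = 0 := by rw [sub_mul, proj_mul_proj, one_mul, sub_self]
  have h1 : (1 - proj ψ) * (1 - proj ψ) = 1 - proj ψ := by rw [mul_sub, h0, mul_one, sub_zero]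
  have h2 := congrArg (fun T => (1 - proj ψ) * T) (h.proj_sub_eq hγ h' hW)
  have h3 : proj ψ' - proj ψ * proj ψ' = (1 - proj ψ) * proj ψ' := by rw [sub_mul, one_mul]
  rw [h3, ← mul_assoc, h1, ← mul_assoc, ← h.inv_mul_compl hγ] at h2
  have h4 : G * (1 - proj ψ) * proj ψ = 0 := by rw [mul_assoc, h0, mul_zero]
  rw [h2, mul_sub (G * (1 - proj ψ)), mul_sub (G * (1 - proj ψ)) (proj ψ'), h4, sub_zero,
    mul_smul_comm]

end SpectralData

variable [CompleteSpace E]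

theorem star_proj (φ : E) : star (proj φ) = proj φ :=
  isSelfAdjoint_starProjection _

namespace SpectralData

/-- The one-sided bound is used in both directions; taking adjoints makes `P P'` the common middle
term. -/
theorem norm_proj_sub_le (h : SpectralData A ψ γ e G) (hγ : 0 < γ)
    (h' : SpectralData A' ψ' γ e' G') (hW : ∀ x : D, A' x = A x + W x) :
    ‖proj ψ' - proj ψ‖ ≤ 4 * γ⁻¹ * ‖W‖ := by
  have h1 := h.norm_proj_sub_mul_le hγ h' hW
  have h2 := h'.norm_proj_sub_mul_le (W := -W) hγ h (fun x => by rw [hW]; simp)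
  rw [norm_neg, ← norm_star, star_sub, star_mul, star_proj, star_proj] at h2
  calc ‖proj ψ' - proj ψ‖
      = ‖(proj ψ' - proj ψ * proj ψ') - (proj ψ - proj ψ * proj ψ')‖ := by congr 1; abel
    _ ≤ 2 * γ⁻¹ * ‖W‖ + 2 * γ⁻¹ * ‖W‖ := (norm_sub_le _ _).trans (add_le_add h1 h2)
    _ = _ := by ring

theorem norm_inv_sub_inv_le (h : SpectralData A ψ γ e G) (hγ : 0 < γ)
    (h' : SpectralData A' ψ' γ e' G') (hW : ∀ x : D, A' x = A x + W x) :
    ‖G' - G‖ ≤ 6 * γ⁻¹ ^ 2 * ‖W‖ := by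
  rw [h.inv_sub_inv h' hW, norm_neg]
  have h1 := h.abs_energy_sub_le h' hW
  have h2 := h.norm_proj_sub_le hγ h' hW
  have h3 : ‖W - ((e' - e : ℝ) : ℂ) • 1 + (γ : ℂ) • (proj ψ' - proj ψ)‖ ≤
      ‖W‖ + ‖W‖ * 1 + γ * (4 * γ⁻¹ * ‖W‖) := by
    refine (norm_add_le _ _).trans (add_le_add ((norm_sub_le _ _).trans
      (add_le_add le_rfl ((norm_smul_le _ _).trans ?_))) ((norm_smul_le _ _).trans ?_))
    · rw [Complex.norm_real, Real.norm_eq_abs]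
      gcongr
      exact ContinuousLinearMap.norm_id_le
    · rw [Complex.norm_real, Real.norm_eq_abs, abs_of_pos hγ]
      gcongr
  calc _ ≤ ‖G'‖ * ‖W - ((e' - e : ℝ) : ℂ) • 1 + (γ : ℂ) • (proj ψ' - proj ψ)‖ * ‖G‖ :=
        norm_mul₃_le
    _ ≤ γ⁻¹ * (‖W‖ + ‖W‖ * 1 + γ * (4 * γ⁻¹ * ‖W‖)) * γ⁻¹ := by
        gcongr
        · exact h'.norm_inv
        · exact h.norm_inv
    _ = _ := by field_simp; ring

end SpectralData

end Algebra

/-! ### Product rules at a zero and a growth estimate for norms. -/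

section Calculus

/-- Where one factor vanishes the other need only be continuous. This allows differentiating
expressions that contain `proj (ψ t)` or `G t` before their differentiability is known. -/
theorem hasDerivWithinAt_mul_of_eq_zero_left {R : Type*} [NormedRing R] [NormedAlgebra ℝ R]
    {f g : ℝ → R} {f' : R} {S : Set ℝ} {s : ℝ} (hf : HasDerivWithinAt f f' S s) (h0 : f s = 0)
    (hg : ContinuousWithinAt g S s) :
    HasDerivWithinAt (fun t => f t * g t) (f' * g s) S s := by
  rw [hasDerivWithinAt_iff_tendsto_slope] at hf ⊢
  refine (hf.mul (hg.mono Set.sdiff_subset)).congr fun t => ?_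
  simp [slope_def_module, h0]

theorem hasDerivWithinAt_mul_of_eq_zero_right {R : Type*} [NormedRing R] [NormedAlgebra ℝ R]
    {f g : ℝ → R} {g' : R} {S : Set ℝ} {s : ℝ} (hf : ContinuousWithinAt f S s) (h0 : g s = 0)
    (hg : HasDerivWithinAt g g' S s) :
    HasDerivWithinAt (fun t => f t * g t) (f s * g') S s := by
  rw [hasDerivWithinAt_iff_tendsto_slope] at hg ⊢
  refine ((hf.mono Set.sdiff_subset).tendsto.mul hg).congr fun t => ?_
  simp [slope_def_module, h0]

theorem hasDerivWithinAt_zero_of_norm_le_sq {F F' : Type*} [NormedAddCommGroup F]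
    [NormedSpace ℝ F] [NormedAddCommGroup F'] [NormedSpace ℝ F'] {f : ℝ → F} {g : ℝ → F'} {g' : F'}
    {S : Set ℝ} {s C : ℝ} (hs : s ∈ S) (hg : HasDerivWithinAt g g' S s)
    (hf : ∀ t ∈ S, ‖f t‖ ≤ C * ‖g t - g s‖ ^ 2) : HasDerivWithinAt f 0 S s := by
  have h0 : f s = 0 := by simpa using hf s hs
  rw [hasDerivWithinAt_iff_isLittleO]
  simp only [h0, sub_zero, smul_zero]
  have h1 : (fun t => g t - g s) =O[nhdsWithin s S] fun t => t - s :=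
    hg.hasFDerivWithinAt.isBigO_sub
  have h2 : f =O[nhdsWithin s S] fun t => ‖g t - g s‖ * ‖g t - g s‖ := by
    refine Asymptotics.IsBigO.of_bound C ?_
    filter_upwards [self_mem_nhdsWithin] with t ht
    simpa [← sq] using hf t ht
  have h3 : (fun t => ‖g t - g s‖) =o[nhdsWithin s S] fun _ => (1 : ℝ) := by
    rw [Asymptotics.isLittleO_one_iff]
    have := (hg.continuousWithinAt.sub (continuousWithinAt_const (b := g s))).norm
    rw [ContinuousWithinAt] at this
    simpa using this
  refine h2.trans_isLittleO ?_
  simpa using h3.mul_isBigO h1.norm_left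

/-- If `‖w‖²` grows at rate at most `2 C ‖w‖`, then `‖w‖` grows at rate at most `C`. -/
theorem norm_le_norm_add_of_re_inner_deriv_le {E : Type*} [NormedAddCommGroup E]
    [InnerProductSpace ℂ E] {w w' : ℝ → E} {C : ℝ} (hC0 : 0 ≤ C)
    (hw : ∀ s ∈ Set.Icc (0 : ℝ) 1, HasDerivWithinAt w (w' s) (Set.Icc 0 1) s)
    (hC : ∀ s ∈ Set.Icc (0 : ℝ) 1, (⟪w s, w' s⟫_ℂ).re ≤ C * ‖w s‖) {s : ℝ}
    (hs : s ∈ Set.Icc (0 : ℝ) 1) : ‖w s‖ ≤ ‖w 0‖ + C * s := by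
  have hsq : ∀ s ∈ Set.Icc (0 : ℝ) 1,
      HasDerivWithinAt (fun t => ‖w t‖ ^ 2) (2 * (⟪w s, w' s⟫_ℂ).re) (Set.Icc 0 1) s := by
    intro s hs
    let _ := InnerProductSpace.rclikeToReal ℂ E
    exact (hw s hs).norm_sq
  -- The norm may fail to be differentiable where `w` vanishes, so `√(‖w‖² + η²)` replaces it, with
  -- `η` arbitrary.
  refine le_of_forall_pos_le_add fun η hη => ?_
  have hpos : ∀ t, 0 < ‖w t‖ ^ 2 + η ^ 2 := fun t => by positivity
  have hle : ∀ t, ‖w t‖ ≤ √(‖w t‖ ^ 2 + η ^ 2) := fun t =>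
    Real.le_sqrt_of_sq_le (by linarith [sq_nonneg η])
  have hsqrt : ∀ s ∈ Set.Icc (0 : ℝ) 1, HasDerivWithinAt (fun t => √(‖w t‖ ^ 2 + η ^ 2))
      (2 * (⟪w s, w' s⟫_ℂ).re / (2 * √(‖w s‖ ^ 2 + η ^ 2))) (Set.Icc 0 1) s := fun s hs =>
    ((hsq s hs).add_const _).sqrt (hpos s).ne'
  have key := image_le_of_deriv_right_le_deriv_boundary
    (f := fun t => √(‖w t‖ ^ 2 + η ^ 2)) (a := 0) (b := 1)
    (fun s hs => (hsqrt s hs).continuousWithinAt)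
    (fun s hs => (hsqrt s ⟨hs.1, hs.2.le⟩).mono_of_mem_nhdsWithin (Icc_mem_nhdsGE_of_mem hs))
    (B := fun t => ‖w 0‖ + η + C * t) (B' := fun _ => C) ?_ (by fun_prop)
    (fun s _ => by
      simpa using (((hasDerivAt_id s).const_mul C).const_add (‖w 0‖ + η)).hasDerivWithinAt) ?_ hs
  · linarith [hle s]
  · rw [mul_zero, add_zero]
    refine Real.sqrt_le_iff.mpr ⟨by positivity, ?_⟩
    nlinarith [norm_nonneg (w 0)]
  · intro s hs
    rw [mul_div_mul_left _ _ two_ne_zero, div_le_iff₀ (Real.sqrt_pos.mpr (hpos s))]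
    exact (hC s ⟨hs.1, hs.2.le⟩).trans (by gcongr; exact hle s)

end Calculus

/-! ### Derivatives of the projection, the energy and the inverse. -/

section Smooth

variable {E : Type*} [NormedAddCommGroup E] [InnerProductSpace ℂ E] [CompleteSpace E]

variable {D : Submodule ℂ E} {A : ℝ → D →ₗ[ℂ] E} {V K₁ K₂ G : ℝ → E →L[ℂ] E} {ψ : ℝ → E}
  {γ : ℝ} {e : ℝ → ℝ} {S : Set ℝ} {s : ℝ}

theorem continuousWithinAt_of_norm_sub_le {F F' : Type*} [NormedAddCommGroup F]
    [NormedAddCommGroup F'] {f : ℝ → F} {g : ℝ → F'} {C : ℝ}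
    (hg : ContinuousWithinAt g S s)
    (hf : ∀ t ∈ S, ‖f t - f s‖ ≤ C * ‖g t - g s‖) : ContinuousWithinAt f S s := by
  rw [ContinuousWithinAt, tendsto_iff_norm_sub_tendsto_zero] at *
  refine squeeze_zero' (.of_forall fun _ => norm_nonneg _)
    (by filter_upwards [self_mem_nhdsWithin] with t ht using hf t ht) ?_
  simpa using hg.const_mul C

/-- With `P_t` the moving projection, `P_t - P = (1 - P) P_t + P P_t (1 - P) - P (1 - P_t) P`. The
first term has an explicit first-order expansion, the second is differentiated as an adjoint, and
the third is quadratically small. -/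
theorem hasDerivWithinAt_proj (hγ : 0 < γ) (hs : s ∈ S)
    (hA : ∀ t ∈ S, SpectralData (A t) (ψ t) γ (e t) (G t))
    (hV : ∀ t ∈ S, ∀ x : D, A t x = A s x + (V t - V s) x)
    (hV' : HasDerivWithinAt V (K₁ s) S s) :
    HasDerivWithinAt (fun t => proj (ψ t))
      (-(G s * (1 - proj (ψ s)) * K₁ s * proj (ψ s) +
        star (G s * (1 - proj (ψ s)) * K₁ s * proj (ψ s)))) S s := by
  set P := proj (ψ s) with hP
  set B := G s * (1 - P) with hB
  have hcont : ContinuousWithinAt (fun t => proj (ψ t)) S s :=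
    continuousWithinAt_of_norm_sub_le hV'.continuousWithinAt fun t ht =>
      (hA s hs).norm_proj_sub_le hγ (hA t ht) (hV t ht)
  have hW : HasDerivWithinAt (fun t => V t - V s) (K₁ s) S s := hV'.sub_const _
  have hf : HasDerivWithinAt (fun t => (1 - P) * proj (ψ t)) (-(B * (K₁ s * P))) S s := by
    have h1 : HasDerivWithinAt
        (fun t => ((e t - e s : ℝ) : ℂ) • (B * (proj (ψ t) - P))) 0 S s := by
      refine hasDerivWithinAt_zero_of_norm_le_sq (C := ‖B‖ * (4 * γ⁻¹)) hs hV' fun t ht => ?_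
      have h2 := (hA s hs).abs_energy_sub_le (hA t ht) (hV t ht)
      have h3 := (hA s hs).norm_proj_sub_le hγ (hA t ht) (hV t ht)
      rw [norm_smul, Complex.norm_real, Real.norm_eq_abs]
      calc _ ≤ ‖V t - V s‖ * (‖B‖ * (4 * γ⁻¹ * ‖V t - V s‖)) := by
            gcongr
            exact (norm_mul_le _ _).trans (by gcongr)
        _ = _ := by ring
    have h2 : HasDerivWithinAt (fun t => B * ((V t - V s) * proj (ψ t))) (B * (K₁ s * P)) S s :=
      (hasDerivWithinAt_mul_of_eq_zero_left hW (sub_self _) hcont).const_mul B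
    have h3 := h1.sub h2
    rw [zero_sub] at h3
    exact h3.congr (fun t ht => (hA s hs).proj_sub_proj_eq hγ (hA t ht) (hV t ht))
      ((hA s hs).proj_sub_proj_eq hγ (hA s hs) (hV s hs))
  have hq : HasDerivWithinAt (fun t => P * (1 - proj (ψ t)) * P) 0 S s := by
    refine hasDerivWithinAt_zero_of_norm_le_sq (C := (4 * γ⁻¹) ^ 2) hs hV' fun t ht => ?_
    have h3 := (hA s hs).norm_proj_sub_le hγ (hA t ht) (hV t ht)
    -- This identity exhibits the diagonal block as quadratic in `P - proj (ψ t)`.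
    have h4 : P * (1 - proj (ψ t)) * P = (P - proj (ψ t)) * (P - proj (ψ t)) * P := by
      have h5 : P * P = P := proj_mul_proj _
      have h6 : proj (ψ t) * proj (ψ t) = proj (ψ t) := proj_mul_proj _
      simp only [mul_sub, sub_mul, mul_one, h5, h6, mul_assoc]
      abel
    rw [h4]
    calc _ ≤ ‖P - proj (ψ t)‖ * ‖P - proj (ψ t)‖ * ‖P‖ := norm_mul₃_le
      _ ≤ (4 * γ⁻¹ * ‖V t - V s‖) * (4 * γ⁻¹ * ‖V t - V s‖) * 1 := by
        rw [norm_sub_rev]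
        gcongr
        exact norm_proj_le _
      _ = _ := by ring
  have hstar : HasDerivWithinAt (fun t => P * (proj (ψ t) * (1 - P)))
      (P * star (-(B * (K₁ s * P)))) S s := by
    refine (hf.star.const_mul P).congr_of_mem (fun t _ => ?_) hs
    simp [star_proj, hP]
  have := (hf.add hstar).sub hq
  refine (this.add_const P).congr_of_mem (fun t _ => ?_) hs |>.congr_deriv ?_
  · have h5 : P * P = P := proj_mul_proj _
    simp only [Pi.add_apply, Pi.sub_apply, mul_sub, sub_mul, mul_one, one_mul, h5, mul_assoc]
    abel
  · simp only [star_neg, star_mul, sub_zero, mul_neg, neg_add, ← mul_assoc, hP, star_proj,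
      proj_mul_proj]

/-- Hellmann–Feynman: pair the eigenvalue equation of `proj (ψ t) (ψ s)` with `ψ s`; the error is a
product of two first-order differences. -/
theorem hasDerivWithinAt_energy (hγ : 0 < γ) (hs : s ∈ S)
    (hA : ∀ t ∈ S, SpectralData (A t) (ψ t) γ (e t) (G t))
    (hV : ∀ t ∈ S, ∀ x : D, A t x = A s x + (V t - V s) x)
    (hV' : HasDerivWithinAt V (K₁ s) S s) :
    HasDerivWithinAt (fun t => (e t : ℂ)) ⟪ψ s, K₁ s (ψ s)⟫_ℂ S s := by
  set P := proj (ψ s) with hP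
  have hcont : ContinuousWithinAt (fun t => proj (ψ t)) S s :=
    continuousWithinAt_of_norm_sub_le hV'.continuousWithinAt fun t ht =>
      (hA s hs).norm_proj_sub_le hγ (hA t ht) (hV t ht)
  have hW : HasDerivWithinAt (fun t => V t - V s) (K₁ s) S s := hV'.sub_const _
  let Λ : (E →L[ℂ] E) →L[ℂ] ℂ :=
    (innerSL ℂ (ψ s)).comp (ContinuousLinearMap.apply ℂ E (ψ s))
  have hΛ : ∀ T, Λ T = ⟪ψ s, T (ψ s)⟫_ℂ := fun T => rfl
  have h1 : HasDerivWithinAt (fun t => Λ ((V t - V s) * proj (ψ t))) (Λ (K₁ s * P)) S s :=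
    (Λ.restrictScalars ℝ).hasFDerivAt.comp_hasDerivWithinAt s
      (hasDerivWithinAt_mul_of_eq_zero_left hW (sub_self _) hcont)
  have hn := (hA s hs).norm_ground
  have h2 : HasDerivWithinAt (fun t => ((e t - e s : ℝ) : ℂ) * Λ (P - proj (ψ t))) 0 S s := by
    refine hasDerivWithinAt_zero_of_norm_le_sq (C := ‖Λ‖ * (4 * γ⁻¹)) hs hV' fun t ht => ?_
    have h2 := (hA s hs).abs_energy_sub_le (hA t ht) (hV t ht)
    have h3 := (hA s hs).norm_proj_sub_le hγ (hA t ht) (hV t ht)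
    rw [norm_mul, Complex.norm_real, Real.norm_eq_abs]
    calc _ ≤ ‖V t - V s‖ * (‖Λ‖ * (4 * γ⁻¹ * ‖V t - V s‖)) := by
          gcongr
          refine (Λ.le_opNorm _).trans ?_
          rw [norm_sub_rev]
          gcongr
      _ = _ := by ring
  have h3 := ((h1.add h2).add_const (e s : ℂ)).congr_deriv (f' := _)
    (g' := ⟪ψ s, K₁ s (ψ s)⟫_ℂ) (by
      rw [add_zero, hΛ]
      exact congrArg (fun z => ⟪ψ s, K₁ s z⟫_ℂ) (proj_self _))
  refine h3.congr_of_mem (fun t ht => ?_) hs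
  have h5 : ⟪ψ s, (V t - V s) (proj (ψ t) (ψ s))⟫_ℂ =
      ((e t - e s : ℝ) : ℂ) * ⟪ψ s, proj (ψ t) (ψ s)⟫_ℂ := by
    have h6 := (hA t ht).map_proj (ψ s)
    rw [hV t ht, ← eq_sub_iff_add_eq'] at h6
    rw [h6, inner_sub_right, inner_smul_right,
      ← (hA s hs).symm ⟨ψ s, (hA s hs).ground_mem⟩ ⟨_, _⟩, (hA s hs).map_ground,
      inner_smul_left, Complex.conj_ofReal]
    push_cast
    ring
  have h7 : Λ P = 1 := by
    rw [hΛ, hP, proj_self, inner_self_eq_norm_sq_to_K, hn]; simp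
  rw [Pi.add_apply, map_sub, h7, hΛ, hΛ]
  erw [h5]
  push_cast
  ring

theorem hasDerivWithinAt_inv (hγ : 0 < γ) (hs : s ∈ S)
    (hA : ∀ t ∈ S, SpectralData (A t) (ψ t) γ (e t) (G t))
    (hV : ∀ t ∈ S, ∀ x : D, A t x = A s x + (V t - V s) x)
    (hV' : HasDerivWithinAt V (K₁ s) S s) {P' : E →L[ℂ] E} {e' : ℂ}
    (hP : HasDerivWithinAt (fun t => proj (ψ t)) P' S s)
    (he : HasDerivWithinAt (fun t => (e t : ℂ)) e' S s) :
    HasDerivWithinAt G (-(G s * (K₁ s - e' • 1 + (γ : ℂ) • P') * G s)) S s := by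
  have hcont : ContinuousWithinAt G S s :=
    continuousWithinAt_of_norm_sub_le hV'.continuousWithinAt fun t ht =>
      (hA s hs).norm_inv_sub_inv_le hγ (hA t ht) (hV t ht)
  have hR : HasDerivWithinAt (fun t => (V t - V s) - ((e t - e s : ℝ) : ℂ) • (1 : E →L[ℂ] E) +
      (γ : ℂ) • (proj (ψ t) - proj (ψ s))) (K₁ s - e' • 1 + (γ : ℂ) • P') S s := by
    refine ((hV'.sub_const _).sub ?_).add ((hP.sub_const _).const_smul (γ : ℂ))
    have h1 : HasDerivWithinAt (fun t => ((e t - e s : ℝ) : ℂ)) e' S s := by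
      simpa using he.sub_const (e s : ℂ)
    exact h1.smul_const (1 : E →L[ℂ] E)
  have h2 := ((hasDerivWithinAt_mul_of_eq_zero_right hcont (by simp) hR).mul_const (G s)).neg
  refine (h2.add_const (G s)).congr_of_mem (fun t ht => ?_) hs
  rw [← sub_eq_iff_eq_add]
  exact (hA s hs).inv_sub_inv (hA t ht) (hV t ht)

end Smooth

/-! ### The corrected leak and its growth along a solution. -/

section Transfer

variable {E : Type*} [NormedAddCommGroup E] [InnerProductSpace ℂ E]

variable {D : Submodule ℂ E} {A : ℝ → D →ₗ[ℂ] E} {V K₁ K₂ G : ℝ → E →L[ℂ] E} {ψ : ℝ → E}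
  {γ b₁ b₂ : ℝ} {e : ℝ → ℝ} {S : Set ℝ} {s : ℝ}

theorem hasDerivWithinAt_clm_apply {T : ℝ → E →L[ℂ] E} {T' : E →L[ℂ] E} {x : ℝ → E} {x' : E}
    (hT : HasDerivWithinAt T T' S s) (hx : HasDerivWithinAt x x' S s) :
    HasDerivWithinAt (fun t => T t (x t)) (T' (x s) + T s x') S s :=
  ((ContinuousLinearMap.restrictScalarsL ℂ E E ℝ ℝ).hasFDerivAt.comp_hasDerivWithinAt s
    hT).clm_apply hx

theorem re_inner_schrodinger {D : Submodule ℂ E} {A : D →ₗ[ℂ] E}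
    (hA : ∀ x y : D, ⟪A x, (y : E)⟫_ℂ = ⟪(x : E), A y⟫_ℂ) (τ : ℝ) (x : D) :
    (⟪(x : E), -(Complex.I * (τ : ℂ)) • A x⟫_ℂ).re = 0 := by
  have h1 : (⟪(x : E), A x⟫_ℂ).im = 0 := by
    rw [← Complex.conj_eq_iff_im, inner_conj_symm]
    exact hA x x
  simp [inner_smul_right, h1]

theorem norm_le_of_schrodinger {x : ℝ → E} {τ : ℝ}
    (hA : ∀ s ∈ Set.Icc (0 : ℝ) 1, ∀ x y : D, ⟪A s x, (y : E)⟫_ℂ = ⟪(x : E), A s y⟫_ℂ)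
    (hx : ∀ s ∈ Set.Icc (0 : ℝ) 1, ∃ h : x s ∈ D,
      HasDerivWithinAt x (-(Complex.I * (τ : ℂ)) • A s ⟨x s, h⟩) (Set.Icc 0 1) s)
    (hs : s ∈ Set.Icc (0 : ℝ) 1) : ‖x s‖ ≤ ‖x 0‖ := by
  choose hm hd using hx
  let x' : ℝ → E := fun s => if h : s ∈ Set.Icc (0 : ℝ) 1 then
    -(Complex.I * (τ : ℂ)) • A s ⟨x s, hm s h⟩ else 0
  have h1 := norm_le_norm_add_of_re_inner_deriv_le (w := x) (w' := x') (C := 0) le_rfl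
    (fun s hs => by simpa only [x', dif_pos hs] using hd s hs)
    (fun s hs => by
      simp only [x', dif_pos hs, zero_mul]
      exact (re_inner_schrodinger (hA s hs) τ ⟨x s, hm s hs⟩).le) hs
  simpa using h1

theorem norm_transfer_le (hγ : 0 < γ) {A : D →ₗ[ℂ] E} {ψ : E} {e : ℝ} {G K : E →L[ℂ] E}
    (hA : SpectralData A ψ γ e G) (hb : ‖K‖ ≤ b₁) :
    ‖G * G * (1 - proj ψ) * K * proj ψ‖ ≤ γ⁻¹ ^ 2 * b₁ := by
  have hQ1 : ‖1 - proj ψ‖ ≤ 1 := norm_id_sub_proj_le _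
  calc _ ≤ ‖G‖ * ‖G‖ * ‖1 - proj ψ‖ * ‖K‖ * ‖proj ψ‖ :=
        (norm_mul_le _ _).trans (by
          gcongr
          exact (norm_mul_le _ _).trans (by gcongr; exact norm_mul₃_le))
    _ ≤ γ⁻¹ * γ⁻¹ * 1 * b₁ * 1 := by
        have := (norm_nonneg K).trans hb
        gcongr
        · exact hA.norm_inv
        · exact hA.norm_inv
        · exact norm_proj_le _
    _ = _ := by ring

variable [CompleteSpace E]

/-- This is the corrector `T = G M`. Its derivative is the only source of growth of the corrected
leak. -/
theorem exists_hasDerivWithinAt_transfer (hγ : 0 < γ) (hs : s ∈ S)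
    (hA : ∀ t ∈ S, SpectralData (A t) (ψ t) γ (e t) (G t))
    (hV : ∀ t ∈ S, ∀ x : D, A t x = A s x + (V t - V s) x)
    (hV' : HasDerivWithinAt V (K₁ s) S s) (hK : HasDerivWithinAt K₁ (K₂ s) S s)
    (hb₁ : ‖K₁ s‖ ≤ b₁) (hb₂ : ‖K₂ s‖ ≤ b₂) :
    ∃ T' : E →L[ℂ] E,
      HasDerivWithinAt (fun t => G t * G t * (1 - proj (ψ t)) * K₁ t * proj (ψ t)) T' S s ∧
      ‖T'‖ ≤ γ⁻¹ ^ 2 * (b₂ + 12 * b₁ ^ 2 * γ⁻¹) := by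
  have hP := hasDerivWithinAt_proj hγ hs hA hV hV'
  have he := hasDerivWithinAt_energy hγ hs hA hV hV'
  have hG := hasDerivWithinAt_inv hγ hs hA hV hV' hP he
  have hb₁0 : 0 ≤ b₁ := (norm_nonneg _).trans hb₁
  have hb₂0 : 0 ≤ b₂ := (norm_nonneg _).trans hb₂
  have hP1 : ‖proj (ψ s)‖ ≤ 1 := norm_proj_le _
  have hQ1 : ‖1 - proj (ψ s)‖ ≤ 1 := norm_id_sub_proj_le _
  have hG1 := (hA s hs).norm_inv
  have hψ := (hA s hs).norm_ground
  set M := G s * (1 - proj (ψ s)) * K₁ s * proj (ψ s) with hM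
  have hM1 : ‖M‖ ≤ γ⁻¹ * b₁ := by
    calc ‖M‖ ≤ ‖G s‖ * ‖1 - proj (ψ s)‖ * ‖K₁ s‖ * ‖proj (ψ s)‖ :=
          (norm_mul_le _ _).trans (by gcongr; exact norm_mul₃_le)
      _ ≤ γ⁻¹ * 1 * b₁ * 1 := by gcongr
      _ = _ := by ring
  set P' := -(M + star M) with hP'
  have hP'1 : ‖P'‖ ≤ 2 * γ⁻¹ * b₁ := by
    rw [hP', norm_neg]
    refine (norm_add_le _ _).trans ?_
    rw [norm_star]
    linarith
  have he1 : ‖⟪ψ s, K₁ s (ψ s)⟫_ℂ‖ ≤ b₁ := by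
    refine (norm_inner_le_norm _ _).trans ?_
    rw [hψ, one_mul]
    refine ((K₁ s).le_opNorm _).trans ?_
    rwa [hψ, mul_one]
  set G' := -(G s * (K₁ s - ⟪ψ s, K₁ s (ψ s)⟫_ℂ • 1 + (γ : ℂ) • P') * G s) with hG'
  have hG'1 : ‖G'‖ ≤ 4 * b₁ * γ⁻¹ ^ 2 := by
    rw [hG', norm_neg]
    have h1 : ‖K₁ s - ⟪ψ s, K₁ s (ψ s)⟫_ℂ • 1 + (γ : ℂ) • P'‖ ≤
        b₁ + b₁ * 1 + γ * (2 * γ⁻¹ * b₁) := by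
      refine (norm_add_le _ _).trans (add_le_add ((norm_sub_le _ _).trans
        (add_le_add hb₁ ?_)) ?_)
      · rw [norm_smul]
        gcongr
        exact ContinuousLinearMap.norm_id_le
      · rw [norm_smul, Complex.norm_real, Real.norm_eq_abs, abs_of_pos hγ]
        gcongr
    calc _ ≤ _ := norm_mul₃_le
      _ ≤ γ⁻¹ * (b₁ + b₁ * 1 + γ * (2 * γ⁻¹ * b₁)) * γ⁻¹ := by gcongr
      _ = _ := by field_simp; ring
  have hT := (((hG.mul hG).mul (hP.const_sub 1)).mul hK).mul hP
  refine ⟨_, hT, ?_⟩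
  simp only [Pi.mul_apply]
  calc _ ≤ (((‖G'‖ * ‖G s‖ + ‖G s‖ * ‖G'‖) * ‖1 - proj (ψ s)‖ + ‖G s‖ * ‖G s‖ * ‖P'‖) * ‖K₁ s‖
          + ‖G s‖ * ‖G s‖ * ‖1 - proj (ψ s)‖ * ‖K₂ s‖) * ‖proj (ψ s)‖ +
          ‖G s‖ * ‖G s‖ * ‖1 - proj (ψ s)‖ * ‖K₁ s‖ * ‖P'‖ := by
        have hm : ∀ {X Y : E →L[ℂ] E} {a b : ℝ}, ‖X‖ ≤ a → ‖Y‖ ≤ b → ‖X * Y‖ ≤ a * b :=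
          fun hX hY => (norm_mul_le _ _).trans (mul_le_mul hX hY (norm_nonneg _)
            ((norm_nonneg _).trans hX))
        have ha : ∀ {X Y : E →L[ℂ] E} {a b : ℝ}, ‖X‖ ≤ a → ‖Y‖ ≤ b → ‖X + Y‖ ≤ a + b :=
          fun hX hY => (norm_add_le _ _).trans (add_le_add hX hY)
        exact ha (hm (ha (hm (ha (hm (ha (hm le_rfl le_rfl) (hm le_rfl le_rfl)) le_rfl)
          (hm (hm le_rfl le_rfl) (norm_neg P').le)) le_rfl)
          (hm (hm (hm le_rfl le_rfl) le_rfl) le_rfl)) le_rfl)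
          (hm (hm (hm (hm le_rfl le_rfl) le_rfl) le_rfl) le_rfl)
    -- The 12 is `4 + 4` from the two factors `G` and `2 + 2` from `1 - P` and the last `P`.
    _ ≤ (((4 * b₁ * γ⁻¹ ^ 2 * γ⁻¹ + γ⁻¹ * (4 * b₁ * γ⁻¹ ^ 2)) * 1 + γ⁻¹ * γ⁻¹ * (2 * γ⁻¹ * b₁)) * b₁
          + γ⁻¹ * γ⁻¹ * 1 * b₂) * 1 + γ⁻¹ * γ⁻¹ * 1 * b₁ * (2 * γ⁻¹ * b₁) := by
        gcongr
    _ = _ := by ring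

/-- The adiabatic theorem for a solution of the Schrödinger equation: the component orthogonal to
the ground state grows by at most a constant multiple of `1 / τ`. -/
theorem norm_sub_proj_le_of_schrodinger (hγ : 0 < γ)
    (hA : ∀ t ∈ Set.Icc (0 : ℝ) 1, SpectralData (A t) (ψ t) γ (e t) (G t))
    (hV : ∀ s ∈ Set.Icc (0 : ℝ) 1, ∀ t ∈ Set.Icc (0 : ℝ) 1, ∀ x : D,
      A t x = A s x + (V t - V s) x)
    (hV' : ∀ s ∈ Set.Icc (0 : ℝ) 1, HasDerivWithinAt V (K₁ s) (Set.Icc 0 1) s)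
    (hK : ∀ s ∈ Set.Icc (0 : ℝ) 1, HasDerivWithinAt K₁ (K₂ s) (Set.Icc 0 1) s)
    (hb₁ : ∀ s ∈ Set.Icc (0 : ℝ) 1, ‖K₁ s‖ ≤ b₁) (hb₂ : ∀ s ∈ Set.Icc (0 : ℝ) 1, ‖K₂ s‖ ≤ b₂)
    {τ : ℝ} (hτ : 0 < τ) {x : ℝ → E}
    (hx : ∀ s ∈ Set.Icc (0 : ℝ) 1, ∃ h : x s ∈ D,
      HasDerivWithinAt x (-(Complex.I * (τ : ℂ)) • A s ⟨x s, h⟩) (Set.Icc 0 1) s)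
    (hx0 : ‖x 0‖ ≤ 1) :
    ‖x 1 - proj (ψ 1) (x 1)‖ ≤ ‖x 0 - proj (ψ 0) (x 0)‖ +
      τ⁻¹ * γ⁻¹ ^ 2 * (2 * b₁ + b₂ + 12 * b₁ ^ 2 * γ⁻¹) := by
  have hx1 : ∀ s ∈ Set.Icc (0 : ℝ) 1, ‖x s‖ ≤ 1 := fun s hs =>
    (norm_le_of_schrodinger (fun s hs => (hA s hs).symm) hx hs).trans hx0
  have hT : ∀ s ∈ Set.Icc (0 : ℝ) 1, _ := fun s hs => exists_hasDerivWithinAt_transfer hγ hs hA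
    (hV s hs) (hV' s hs) (hK s hs) (hb₁ s hs) (hb₂ s hs)
  choose! T' hT hT'n using hT
  choose hm hd using hx
  have h0 : (0 : ℝ) ∈ Set.Icc (0 : ℝ) 1 := by simp
  have h1 : (1 : ℝ) ∈ Set.Icc (0 : ℝ) 1 := by simp
  have hb₁0 : 0 ≤ b₁ := (norm_nonneg _).trans (hb₁ 0 h0)
  have hb₂0 : 0 ≤ b₂ := (norm_nonneg _).trans (hb₂ 0 h0)
  set T : ℝ → E →L[ℂ] E := fun t => G t * G t * (1 - proj (ψ t)) * K₁ t * proj (ψ t) with hTdef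
  set c : ℂ := Complex.I * (τ : ℂ)⁻¹ with hc
  have hτ' : (τ : ℂ) ≠ 0 := by exact_mod_cast hτ.ne'
  -- The constant `c = i/τ` is chosen for this cancellation.
  have hcτ : c * (Complex.I * (τ : ℂ)) = -1 := by
    rw [hc]
    field_simp
    exact Complex.I_sq
  have hcn : ‖c‖ = τ⁻¹ := by
    rw [hc, norm_mul, Complex.norm_I, one_mul, norm_inv, Complex.norm_real, Real.norm_eq_abs,
      abs_of_pos hτ]
  let M : ℝ → E →L[ℂ] E := fun s => G s * (1 - proj (ψ s)) * K₁ s * proj (ψ s)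
  let w : ℝ → E := fun t => x t - proj (ψ t) (x t) + c • T t (x t)
  have hTx : ∀ s ∈ Set.Icc (0 : ℝ) 1, T s (x s) ∈ D := fun s hs => (hA s hs).inv_mem _
  have hwm : ∀ s ∈ Set.Icc (0 : ℝ) 1, w s ∈ D := fun s hs =>
    D.add_mem (D.sub_mem (hm s hs) ((hA s hs).proj_mem _)) (D.smul_mem _ (hTx s hs))
  -- The term `M x` coming from `-P' x` is absorbed into the Schrödinger term of `w`, so only `star
  -- (M s) (x s)` survives.
  let w' : ℝ → E := fun s => if h : s ∈ Set.Icc (0 : ℝ) 1 then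
    -(Complex.I * (τ : ℂ)) • A s ⟨w s, hwm s h⟩ + star (M s) (x s) + c • T' s (x s) else 0
  have hw : ∀ s ∈ Set.Icc (0 : ℝ) 1, HasDerivWithinAt w (w' s) (Set.Icc 0 1) s := by
    intro s hs
    have hP := hasDerivWithinAt_proj hγ hs hA (hV s hs) (hV' s hs)
    have h2 := ((hd s hs).sub (hasDerivWithinAt_clm_apply hP (hd s hs))).add
      ((hasDerivWithinAt_clm_apply (hT s hs) (hd s hs)).const_smul c)
    refine h2.congr_deriv ?_
    simp only [w', dif_pos hs]
    have e1 : proj (ψ s) (A s ⟨x s, hm s hs⟩) = (e s : ℂ) • proj (ψ s) (x s) :=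
      (hA s hs).proj_map ⟨x s, hm s hs⟩
    have e2 : T s (A s ⟨x s, hm s hs⟩) = (e s : ℂ) • T s (x s) := by
      change G s (G s ((1 - proj (ψ s)) (K₁ s (proj (ψ s) (A s ⟨x s, hm s hs⟩))))) = _
      rw [e1, map_smul, map_smul, map_smul, map_smul]
      rfl
    have e3 : A s ⟨T s (x s), hTx s hs⟩ = (e s : ℂ) • T s (x s) + M s (x s) := by
      have h3 := (hA s hs).map_inv_sub hγ (M s (x s))
      have h4 : proj (ψ s) * M s = 0 := by
        simp only [M, ← mul_assoc, (hA s hs).proj_mul_inv hγ]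
        rw [smul_mul_assoc, mul_sub, proj_mul_proj]
        simp
      have h5 : proj (ψ s) (M s (x s)) = 0 := congrArg (fun Z : E →L[ℂ] E => Z (x s)) h4
      rw [h5, sub_zero, sub_eq_iff_eq_add'] at h3
      exact h3
    have e4 : A s ⟨w s, hwm s hs⟩ = A s ⟨x s, hm s hs⟩ - (e s : ℂ) • proj (ψ s) (x s) +
        c • ((e s : ℂ) • T s (x s) + M s (x s)) := by
      rw [← e3, ← (hA s hs).map_proj, ← map_smul, ← map_sub, ← map_add]
      rfl
    have e5 : (-(M s + star (M s))) (x s) = -(M s (x s) + star (M s) (x s)) := rfl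
    change _ - ((-(M s + star (M s))) (x s) + proj (ψ s) _) + c • (T' s (x s) + T s _) = _
    rw [e4, e5, map_smul, map_smul, e1, e2]
    have h6 : ∀ y : E, c • (Complex.I * (τ : ℂ)) • y = -y := fun y => by
      rw [smul_smul, hcτ, neg_one_smul]
    have h7 : ∀ y : E, (Complex.I * (τ : ℂ)) • c • y = -y := fun y => by
      rw [smul_smul, mul_comm, hcτ, neg_one_smul]
    simp only [smul_add, smul_sub, neg_smul, smul_neg, h6, h7]
    abel
  have hre : ∀ s ∈ Set.Icc (0 : ℝ) 1,
      (⟪w s, w' s⟫_ℂ).re ≤ τ⁻¹ * (γ⁻¹ ^ 2 * (b₂ + 12 * b₁ ^ 2 * γ⁻¹)) * ‖w s‖ := by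
    intro s hs
    simp only [w', dif_pos hs]
    have hPT : proj (ψ s) * T s = 0 := by
      simp only [hTdef, ← mul_assoc, (hA s hs).proj_mul_inv hγ]
      rw [smul_mul_assoc, (hA s hs).proj_mul_inv hγ, smul_smul, smul_mul_assoc, mul_sub,
        proj_mul_proj]
      simp
    have hPT' : proj (ψ s) (T s (x s)) = 0 := congrArg (fun Z : E →L[ℂ] E => Z (x s)) hPT
    -- Since `M` ends in `P`, this gives `M w = 0`, so the surviving term is orthogonal to `w`.
    have hPw : proj (ψ s) (w s) = 0 := by
      simp only [w, map_add, map_sub, map_smul, proj_proj, hPT', sub_self, smul_zero, add_zero]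
    have hMw : M s (w s) = 0 := by
      change (G s * (1 - proj (ψ s)) * K₁ s) (proj (ψ s) (w s)) = 0
      rw [hPw, map_zero]
    have h2 : ⟪w s, star (M s) (x s)⟫_ℂ = 0 := by
      rw [ContinuousLinearMap.star_eq_adjoint, ContinuousLinearMap.adjoint_inner_right, hMw,
        inner_zero_left]
    rw [inner_add_right, inner_add_right, h2, add_zero, Complex.add_re,
      re_inner_schrodinger (hA s hs).symm τ ⟨w s, hwm s hs⟩, zero_add]
    refine (Complex.re_le_norm _).trans ((norm_inner_le_norm _ _).trans ?_)
    rw [mul_comm, norm_smul, hcn]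
    gcongr
    calc ‖T' s (x s)‖ ≤ ‖T' s‖ * ‖x s‖ := (T' s).le_opNorm _
      _ ≤ (γ⁻¹ ^ 2 * (b₂ + 12 * b₁ ^ 2 * γ⁻¹)) * 1 := by
        gcongr
        · exact hT'n s hs
        · exact hx1 s hs
      _ = _ := mul_one _
  have key := norm_le_norm_add_of_re_inner_deriv_le (by positivity) hw hre h1
  have hcT : ∀ s ∈ Set.Icc (0 : ℝ) 1, ‖c • T s (x s)‖ ≤ τ⁻¹ * (γ⁻¹ ^ 2 * b₁) := by
    intro s hs
    rw [norm_smul, hcn]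
    gcongr
    calc ‖T s (x s)‖ ≤ ‖T s‖ * ‖x s‖ := (T s).le_opNorm _
      _ ≤ (γ⁻¹ ^ 2 * b₁) * 1 := by
        gcongr
        · exact norm_transfer_le hγ (hA s hs) (hb₁ s hs)
        · exact hx1 s hs
      _ = _ := mul_one _
  have k0 : ‖w 0‖ ≤ ‖x 0 - proj (ψ 0) (x 0)‖ + τ⁻¹ * (γ⁻¹ ^ 2 * b₁) :=
    (norm_add_le _ _).trans (add_le_add le_rfl (hcT 0 h0))
  have k1 : ‖x 1 - proj (ψ 1) (x 1)‖ ≤ ‖w 1‖ + τ⁻¹ * (γ⁻¹ ^ 2 * b₁) := by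
    have : x 1 - proj (ψ 1) (x 1) = w 1 - c • T 1 (x 1) := (add_sub_cancel_right _ _).symm
    rw [this]
    exact (norm_sub_le _ _).trans (add_le_add le_rfl (hcT 1 h1))
  refine k1.trans ?_
  calc _ ≤ (‖x 0 - proj (ψ 0) (x 0)‖ + τ⁻¹ * (γ⁻¹ ^ 2 * b₁) +
        τ⁻¹ * (γ⁻¹ ^ 2 * (b₂ + 12 * b₁ ^ 2 * γ⁻¹)) * 1) + τ⁻¹ * (γ⁻¹ ^ 2 * b₁) := by
        gcongr
        exact key.trans (by gcongr)
    _ = _ := by ring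

end Transfer

/-! ### Exchange of ground states at the end points. -/

section Final

variable {E : Type*} [NormedAddCommGroup E] [InnerProductSpace ℂ E]

theorem norm_sub_proj {φ ψ : E} (hφ : ‖φ‖ = 1) (hψ : ‖ψ‖ = 1) :
    ‖φ - proj ψ φ‖ = √(1 - ‖⟪ψ, φ⟫_ℂ‖ ^ 2) := by
  have h0 : ⟪φ - proj ψ φ, proj ψ φ⟫_ℂ = 0 := by
    rw [inner_sub_left, proj_inner ψ φ (proj ψ φ), proj_proj, sub_self]
  have h1 := norm_add_sq_eq_norm_sq_add_norm_sq_of_inner_eq_zero _ _ h0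
  have h2 : ‖proj ψ φ‖ = ‖⟪ψ, φ⟫_ℂ‖ := by rw [proj_apply hψ, norm_smul, hψ, mul_one]
  rw [sub_add_cancel, hφ, h2] at h1
  rw [eq_comm, Real.sqrt_eq_iff_mul_self_eq (by nlinarith [norm_nonneg (φ - proj ψ φ)])
    (norm_nonneg _)]
  linarith

theorem norm_inner_le_one {φ ψ : E} (hφ : ‖φ‖ ≤ 1) (hψ : ‖ψ‖ ≤ 1) : ‖⟪ψ, φ⟫_ℂ‖ ≤ 1 :=
  (norm_inner_le_norm _ _).trans (mul_le_one₀ hψ (norm_nonneg _) hφ)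

theorem vadd_apply_eq {K K₀ : E →ₗ.[ℂ] E} {V : E →ₗ[ℂ] E} (hK : K = V +ᵥ K₀) {y : E}
    (h : y ∈ K.domain) : ∃ h₀ : y ∈ K₀.domain, K ⟨y, h⟩ = V y + K₀ ⟨y, h₀⟩ := by
  subst hK
  exact ⟨h, rfl⟩

/-- Replacing the ground states at both ends changes the transition amplitude by at most the
distances between the ground states. -/
theorem norm_transition_le {U : E →L[ℂ] E} (hU : ∀ x, ‖U x‖ ≤ ‖x‖) {φ₀ φ₁ ψ₀ ψ₁ : E}
    (hφ₀ : ‖φ₀‖ = 1) (hφ₁ : ‖φ₁‖ = 1) (hψ₀ : ‖ψ₀‖ = 1) (hψ₁ : ‖ψ₁‖ = 1) {a : ℝ}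
    (ha : ‖U ψ₀ - proj ψ₁ (U ψ₀)‖ ≤ a) :
    ‖(ContinuousLinearMap.id ℂ E - proj φ₁) ∘L U ∘L proj φ₀‖ ≤
      a + √(1 - ‖⟪ψ₀, φ₀⟫_ℂ‖ ^ 2) + √(1 - ‖⟪ψ₁, φ₁⟫_ℂ‖ ^ 2) := by
  have ha0 := (norm_nonneg _).trans ha
  set Q := ContinuousLinearMap.id ℂ E - proj φ₁ with hQ
  have hQn : ∀ x, ‖Q x‖ ≤ ‖x‖ := fun x => (Q.le_opNorm x).trans
    (mul_le_of_le_one_left (norm_nonneg _) (norm_id_sub_proj_le φ₁))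
  have hQψ : ‖Q ψ₁‖ = √(1 - ‖⟪ψ₁, φ₁⟫_ℂ‖ ^ 2) := by
    rw [norm_inner_symm]
    exact norm_sub_proj hψ₁ hφ₁
  have hψU : ‖Q (U ψ₀)‖ ≤ a + √(1 - ‖⟪ψ₁, φ₁⟫_ℂ‖ ^ 2) := by
    -- The part of `U ψ₀` off `ψ₁` costs `a`; the part along `ψ₁` costs at most the distance from
    -- `ψ₁` to the line of `φ₁`.
    have h1 : U ψ₀ = (U ψ₀ - proj ψ₁ (U ψ₀)) + ⟪ψ₁, U ψ₀⟫_ℂ • ψ₁ := by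
      rw [← proj_apply hψ₁, sub_add_cancel]
    rw [h1, map_add, map_smul]
    refine (norm_add_le _ _).trans (add_le_add ((hQn _).trans ha) ?_)
    rw [norm_smul, hQψ]
    exact mul_le_of_le_one_left (Real.sqrt_nonneg _)
      (norm_inner_le_one ((hU _).trans hψ₀.le) hψ₁.le)
  have hφU : ‖Q (U φ₀)‖ ≤
      a + √(1 - ‖⟪ψ₀, φ₀⟫_ℂ‖ ^ 2) + √(1 - ‖⟪ψ₁, φ₁⟫_ℂ‖ ^ 2) := by
    have h1 : φ₀ = (φ₀ - proj ψ₀ φ₀) + ⟪ψ₀, φ₀⟫_ℂ • ψ₀ := by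
      rw [← proj_apply hψ₀, sub_add_cancel]
    have h2 : Q (U φ₀) = Q (U (φ₀ - proj ψ₀ φ₀)) + ⟪ψ₀, φ₀⟫_ℂ • Q (U ψ₀) := by
      rw [← map_smul, ← map_smul, ← map_add, ← map_add, ← h1]
    have h3 : ‖Q (U (φ₀ - proj ψ₀ φ₀))‖ ≤ √(1 - ‖⟪ψ₀, φ₀⟫_ℂ‖ ^ 2) :=
      ((hQn _).trans (hU _)).trans (norm_sub_proj hφ₀ hψ₀).le
    have h4 : ‖⟪ψ₀, φ₀⟫_ℂ • Q (U ψ₀)‖ ≤ ‖Q (U ψ₀)‖ := by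
      rw [norm_smul]
      exact mul_le_of_le_one_left (norm_nonneg _) (norm_inner_le_one hφ₀.le hψ₀.le)
    rw [h2]
    linarith [norm_add_le (Q (U (φ₀ - proj ψ₀ φ₀))) (⟪ψ₀, φ₀⟫_ℂ • Q (U ψ₀))]
  refine ContinuousLinearMap.opNorm_le_bound _ (by positivity) fun x => ?_
  change ‖Q (U (proj φ₀ x))‖ ≤ _
  rw [proj_apply hφ₀, map_smul, map_smul, norm_smul, mul_comm]
  gcongr
  refine (norm_inner_le_norm _ _).trans ?_
  rw [hφ₀, one_mul]

end Final

end Adiabatic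

/-! ### Assembly of the adiabatic estimate. -/

theorem mainTheorem3 {E : Type*} [NormedAddCommGroup E] [InnerProductSpace ℂ E] [CompleteSpace E]
    (H Δ Hε : ℝ → E →ₗ.[ℂ] E) (ε : ℝ)
    -- the perturbed Hamiltonian
    (hHε : ∀ s ∈ Set.Icc (0 : ℝ) 1, Hε s = H s + (ε : ℂ) • Δ s)
    (hH_ham : ∀ s ∈ Set.Icc (0 : ℝ) 1, Adiabatic.IsHamiltonian (H s))
    (hHε_ham : ∀ s ∈ Set.Icc (0 : ℝ) 1, Adiabatic.IsHamiltonian (Hε s))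
    -- its two derivatives and their bounds
    (Hε₁ Hε₂ : ℝ → E →L[ℂ] E) (hdiff : Adiabatic.HasTwoDerivatives Hε Hε₁ Hε₂)
    (b₁ b₂ : ℝ)
    (hb₁ : ∀ s ∈ Set.Icc (0 : ℝ) 1, ‖Hε₁ s‖ ≤ b₁)
    (hb₂ : ∀ s ∈ Set.Icc (0 : ℝ) 1, ‖Hε₂ s‖ ≤ b₂)
    -- the perturbed and the unperturbed ground states, and the gap of the perturbed Hamiltonian
    (ψ : ℝ → E) (hψ : ∀ s ∈ Set.Icc (0 : ℝ) 1, Adiabatic.IsGroundState (Hε s) (ψ s))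
    (γ : ℝ) (hγ : 0 < γ) (hgap : ∀ s ∈ Set.Icc (0 : ℝ) 1, Adiabatic.HasGap (Hε s) γ)
    (φ : ℝ → E) (hφ0 : Adiabatic.IsGroundState (H 0) (φ 0))
    (hφ1 : Adiabatic.IsGroundState (H 1) (φ 1))
    (δ₀ δ₁ : ℝ)
    (hδ₀ : δ₀ = Real.sqrt (1 - ‖inner ℂ (ψ 0) (φ 0)‖ ^ 2))
    (hδ₁ : δ₁ = Real.sqrt (1 - ‖inner ℂ (ψ 1) (φ 1)‖ ^ 2))
    -- the perturbed evolution
    (τ : ℝ) (hτ : 0 < τ) (Uε : ℝ → E →L[ℂ] E) (hU : Adiabatic.IsEvolution Hε τ Uε) :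
    ‖(ContinuousLinearMap.id ℂ E - Adiabatic.proj (φ 1)) ∘L Uε 1 ∘L Adiabatic.proj (φ 0)‖ ≤
      8 / (τ * γ ^ 2) * (2 * b₁ + b₂ + 16 * b₁ ^ 2 / γ) + δ₀ + δ₁ + δ₀ * δ₁ := by
  obtain ⟨V, hV⟩ := hdiff
  obtain ⟨hU0, hU⟩ := hU
  have h0 : (0 : ℝ) ∈ Set.Icc (0 : ℝ) 1 := by simp
  have h1 : (1 : ℝ) ∈ Set.Icc (0 : ℝ) 1 := by simp
  -- All operators are carried to the one domain of `Hε 0`, so that they can be compared.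
  let A : ℝ → (Hε 0).domain →ₗ[ℂ] E := fun s =>
    (V s : E →ₗ[ℂ] E) ∘ₗ (Hε 0).domain.subtype + (Hε 0).toFun
  have hA : ∀ s ∈ Set.Icc (0 : ℝ) 1, ∃ (e : ℝ) (G : E →L[ℂ] E),
      Adiabatic.SpectralData (A s) (ψ s) γ e G := by
    intro s hs
    have hh := hHε_ham s hs
    have hg := hψ s hs
    have hgp := hgap s hs
    rw [(hV s hs).1] at hh hg hgp
    exact Adiabatic.exists_spectralData hh hg hγ hgp
  choose! e G hA using hA
  have hAV : ∀ s ∈ Set.Icc (0 : ℝ) 1, ∀ t ∈ Set.Icc (0 : ℝ) 1, ∀ x : (Hε 0).domain,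
      A t x = A s x + (V t - V s) x := by
    intro s _ t _ x
    change V t x + Hε 0 x = V s x + Hε 0 x + (V t x - V s x)
    abel
  have hsol : ∀ x ∈ (Hε 0).domain, ∀ s ∈ Set.Icc (0 : ℝ) 1, ∃ h : Uε s x ∈ (Hε 0).domain,
      HasDerivWithinAt (fun r => Uε r x) (-(Complex.I * (τ : ℂ)) • A s ⟨Uε s x, h⟩)
        (Set.Icc 0 1) s := by
    intro x hx s hs
    obtain ⟨h, hd⟩ := hU x hx s hs
    obtain ⟨h', he⟩ := Adiabatic.vadd_apply_eq (hV s hs).1 h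
    rw [he] at hd
    exact ⟨h', hd⟩
  -- The evolution equation is available only on the domain; density extends the contraction bound
  -- to all vectors, as needed for `φ 0`.
  have hcontr : ∀ x, ‖Uε 1 x‖ ≤ ‖x‖ := by
    have hdense : Dense ((Hε 0).domain : Set E) := (hHε_ham 0 h0).1.dense_domain
    refine isClosed_property hdense.denseRange_val
      (isClosed_le (by fun_prop) continuous_norm) fun x => ?_
    have := Adiabatic.norm_le_of_schrodinger (fun s hs => (hA s hs).symm) (hsol x x.2) h1
    rwa [hU0] at this
  have hψ0 := (hA 0 h0).norm_ground
  have key := Adiabatic.norm_sub_proj_le_of_schrodinger hγ hA hAV (fun s hs => (hV s hs).2.1)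
    (fun s hs => (hV s hs).2.2) hb₁ hb₂ hτ (hsol (ψ 0) (hA 0 h0).ground_mem)
    (by rw [hU0]; exact hψ0.le)
  -- Starting in `ψ 0` makes the initial leak zero.
  simp only [hU0, ContinuousLinearMap.id_apply, Adiabatic.proj_self, sub_self, norm_zero,
    zero_add] at key
  have hmain := Adiabatic.norm_transition_le hcontr hφ0.1 hφ1.1 hψ0 (hA 1 h1).norm_ground key
  rw [← hδ₀, ← hδ₁] at hmain
  have hδ : 0 ≤ δ₀ * δ₁ := by rw [hδ₀, hδ₁]; positivity
  have hb₁0 : 0 ≤ b₁ := (norm_nonneg _).trans (hb₁ 0 h0)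
  have hb₂0 : 0 ≤ b₂ := (norm_nonneg _).trans (hb₂ 0 h0)
  -- Only slack remains: `1 ≤ 8` and `12 ≤ 16`.
  have hfin : τ⁻¹ * γ⁻¹ ^ 2 * (2 * b₁ + b₂ + 12 * b₁ ^ 2 * γ⁻¹) ≤
      8 / (τ * γ ^ 2) * (2 * b₁ + b₂ + 16 * b₁ ^ 2 / γ) := by
    have h8 : 8 / (τ * γ ^ 2) = 8 * (τ⁻¹ * γ⁻¹ ^ 2) := by field_simp
    rw [h8, div_eq_mul_inv (16 * b₁ ^ 2)]
    refine mul_le_mul (le_mul_of_one_le_left (by positivity) (by norm_num)) ?_ (by positivity)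
      (by positivity)
    gcongr
    norm_num
  linarith
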